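/- **Corollary 4.7.** Let $\{\mu_n\}_{n\in\mathbb N}$ be a uniformly computable sequence of finite Borel measures on $\mathbb R$, and suppose that it effectively weakly converges to a finite Borel measure $\mu$ on $\mathbb R$. Then $\{\mu_n\}_{n\in\mathbb N}$ weakly converges to $\mu$, that is, $$\lim_{n\to\infty}\int_{\mathbb R} f\,d\mu_n=\int_{\mathbb R} f\,d\mu\qquad\text{for every bounded continuous } f:\mathbb R\to\mathbb R .$$ Here the following terminology is used. * A *Cauchy name* of a real $x$ is a sequence of rationals $(q_n)_{n\in\mathbb N}$ with $q_n\to x$ and $|q_n-q_{n+1}|<2^{-n}$ for all $n$ (rationals being coded by natural numbers through a fixed effective numbering). An *index* of a computable real $x$ is an index of a computable Cauchy name of $x$. The real $x$ is *left-c.e.* if its left Dedekind cut $\{q\in\mathbb Q: q<x\}$ is c.e. * A function $f:\mathbb R\to\mathbb R$ is *computable* if some Turing functional maps every Cauchy name of every real $x$ to a Cauchy name of $f(x)$; an *index* of $f$ is an index of such a functional. * Let $\{I_i\}_{i\in\mathbb N}$ be a fixed effective enumeration of the bounded open intervals with rational endpoints. An open set $U\subseteq\mathbb R$ is $\Sigma^0_1$,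 with *index* $e$, if $e$ is an index of $\{i: I_i\subseteq U\}$ as a c.e. set. * A finite Borel measure $\nu$ on $\mathbb R$ is *computable* if $\nu(\mathbb R)$ is a computable real and there is an algorithm that computes an index of the left Dedekind cut of $\nu(U)$ (as a c.e. set) from any index of any $\Sigma^0_1$ set $U$; an index of $\nu$ consists of an index of the real $\nu(\mathbb R)$ and an index of such an algorithm. The sequence $\{\mu_n\}$ is *uniformly computable* if an index of $\mu_n$ can be computed from $n$. * A *modulus of convergence* of a sequence of reals $\{a_n\}$ with limit $a$ is a function $g:\mathbb N\to\mathbb N$ such that $|a_n-a|<2^{-k}$ whenever $n\ge g(k)$. * $\{\mu_n\}$ *effectively weakly converges* to $\mu$ if $\lim_n\int_{\mathbb R} f\,d\mu_n=\int_{\mathbb R} f\,d\mu$ for every bounded computable $f:\mathbb R\to\mathbb R$, and there is an algorithm that, given any index of any such $f$ and any $B\in\mathbb N$ with $|f|\le B$, computes an index of a computable modulus of convergence of $\{\int_{\mathbb R} f\,d\mu_n\}_{n\in\mathbb N}$. -/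

import Mathlib

namespace EffWeak

open MeasureTheory Filter Topology

/-! ### Indices of partial recursive functions and of c.e. sets -/

/-- The `e`-th partial recursive function. -/
def phi (e : ℕ) : ℕ →. ℕ := (Denumerable.ofNat Nat.Partrec.Code e).eval

/-- `e` is an index of the total computable function `g`. -/
def IsFunctionIndex (e : ℕ) (g : ℕ → ℕ) : Prop := ∀ n, g n ∈ phi e n

/-- `e` is an index of the c.e. set `A`, that is, `A` is the domain of the `e`-th partial
recursive function. -/
def IsCEIndex (e : ℕ) (A : Set ℕ) : Prop := ∀ n, n ∈ A ↔ (phi e n).Dom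

/-! ### Turing functionals -/

/-- Programs for oracle computation: the basic functions, the oracle, and closure under pairing,
composition, primitive recursion and unbounded search. -/
inductive OracleCode : Type
  | zero : OracleCode
  | succ : OracleCode
  | left : OracleCode
  | right : OracleCode
  | oracle : OracleCode
  | pair : OracleCode → OracleCode → OracleCode
  | comp : OracleCode → OracleCode → OracleCode
  | prec : OracleCode → OracleCode → OracleCode
  | rfind : OracleCode → OracleCode

/-- The partial function computed by a program when its oracle is `ρ`. The clauses are those of
`Nat.RecursiveIn`. -/
def OracleCode.eval (ρ : ℕ → ℕ) : OracleCode → ℕ →. ℕ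
  | OracleCode.zero => fun _ => Part.some 0
  | OracleCode.succ => fun n => Part.some (n + 1)
  | OracleCode.left => fun n => Part.some n.unpair.1
  | OracleCode.right => fun n => Part.some n.unpair.2
  | OracleCode.oracle => fun n => Part.some (ρ n)
  | OracleCode.pair c d => fun n => Nat.pair <$> OracleCode.eval ρ c n <*> OracleCode.eval ρ d n
  | OracleCode.comp c d => fun n => OracleCode.eval ρ d n >>= OracleCode.eval ρ c
  | OracleCode.prec c d => Nat.unpaired fun a n =>
      n.rec (OracleCode.eval ρ c a) fun y IH => do
        let i ← IH
        OracleCode.eval ρ d (Nat.pair a (Nat.pair y i))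
  | OracleCode.rfind c => fun a =>
      Nat.rfind fun n => (fun m => decide (m = 0)) <$> OracleCode.eval ρ c (Nat.pair a n)

/-- The Gödel number of an oracle program. -/
def OracleCode.encode : OracleCode → ℕ
  | OracleCode.zero => 0
  | OracleCode.succ => 1
  | OracleCode.left => 2
  | OracleCode.right => 3
  | OracleCode.oracle => 4
  | OracleCode.pair c d => 4 * Nat.pair (OracleCode.encode c) (OracleCode.encode d) + 5
  | OracleCode.comp c d => 4 * Nat.pair (OracleCode.encode c) (OracleCode.encode d) + 6
  | OracleCode.prec c d => 4 * Nat.pair (OracleCode.encode c) (OracleCode.encode d) + 7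
  | OracleCode.rfind c => 4 * OracleCode.encode c + 8

/-! ### Rational numbers, real numbers and real functions -/

/-- An effective surjective numbering of the rational numbers: the number coding the triple
`(a, b, c)` names `(a - b) / (c + 1)`. -/
def rat (n : ℕ) : ℚ :=
  ((n.unpair.1 : ℚ) - (n.unpair.2.unpair.1 : ℚ)) / ((n.unpair.2.unpair.2 : ℚ) + 1)

/-- `ρ` is (the coded form of) a Cauchy name of `x`: the rationals `q n = rat (ρ n)` converge to
`x`, and `|q n - q (n + 1)| < 2 ^ (-n)` for all `n`. -/
def IsCauchyName (ρ : ℕ → ℕ) (x : ℝ) : Prop :=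
  Tendsto (fun n => ((rat (ρ n) : ℚ) : ℝ)) atTop (𝓝 x) ∧
    ∀ n, |rat (ρ n) - rat (ρ (n + 1))| < (1 / 2 : ℚ) ^ n

/-- `e` is an index of the computable real `x`: it is an index of a Cauchy name of `x`. -/
def IsRealIndex (e : ℕ) (x : ℝ) : Prop := ∃ ρ : ℕ → ℕ, IsFunctionIndex e ρ ∧ IsCauchyName ρ x

/-- `e` is an index of the left Dedekind cut of the left-c.e. real `x`. -/
def IsLeftCutIndex (e : ℕ) (x : ℝ) : Prop := IsCEIndex e {i | ((rat i : ℚ) : ℝ) < x}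

/-- `e` is an index of the computable function `f : ℝ → ℝ`: it is the index of a Turing functional
that maps every Cauchy name of every real `x` to a Cauchy name of `f x`. -/
def IsRealFunctionIndex (e : ℕ) (f : ℝ → ℝ) : Prop :=
  ∃ c : OracleCode, c.encode = e ∧
    ∀ (x : ℝ) (ρ : ℕ → ℕ), IsCauchyName ρ x →
      ∃ σ : ℕ → ℕ, (∀ n, σ n ∈ c.eval ρ n) ∧ IsCauchyName σ (f x)

/-! ### Effectively open sets and computable measures -/

/-- An effective enumeration of the bounded open intervals with rational endpoints. -/
def ratInterval (i : ℕ) : Set ℝ :=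
  Set.Ioo ((rat i.unpair.1 : ℚ) : ℝ) ((rat i.unpair.2 : ℚ) : ℝ)

/-- `e` is an index of the `Σ⁰₁` set `U`: the set `U` is open and `e` is an index of the set of all
`i` such that the `i`-th rational open interval is contained in `U`. -/
def IsSigmaIndex (e : ℕ) (U : Set ℝ) : Prop := IsOpen U ∧ IsCEIndex e {i | ratInterval i ⊆ U}

/-- `e` is an index of the computable finite Borel measure `μ` on `ℝ`: the first component of `e` is
an index of the computable real `μ ℝ`, and the second one is an index of a partial recursive
function that maps every index of every `Σ⁰₁` set `U` to an index of the left cut of `μ U`. -/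
def IsMeasureIndex (e : ℕ) (μ : FiniteMeasure ℝ) : Prop :=
  IsRealIndex e.unpair.1 ((μ : Measure ℝ).real Set.univ) ∧
    ∀ (U : Set ℝ) (u : ℕ), IsSigmaIndex u U →
      ∃ l ∈ phi e.unpair.2 u, IsLeftCutIndex l ((μ : Measure ℝ).real U)

/-- The measures `μs n` are computable uniformly in `n`. -/
def UniformlyComputable (μs : ℕ → FiniteMeasure ℝ) : Prop :=
  ∃ g : ℕ → ℕ, Computable g ∧ ∀ n, IsMeasureIndex (g n) (μs n)

/-! ### Convergence of measures -/

/-- `g` is a modulus of convergence of the sequence `a` to `l`. -/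
def IsModulus (g : ℕ → ℕ) (a : ℕ → ℝ) (l : ℝ) : Prop :=
  ∀ k n, g k ≤ n → |a n - l| < (1 / 2 : ℝ) ^ k

/-- The sequence `μs` effectively weakly converges to `μ`: for every bounded computable
`f : ℝ → ℝ` the integrals of `f` converge, and there is one algorithm that computes an index of a
modulus of convergence of these integrals from any index `e` of any such `f` and any bound
`B : ℕ` on `|f|`. -/
def EffectivelyWeaklyConverges (μs : ℕ → FiniteMeasure ℝ) (μ : FiniteMeasure ℝ) : Prop :=
  (∀ f : ℝ → ℝ, (∃ e, IsRealFunctionIndex e f) → (∃ B : ℝ, ∀ x, |f x| ≤ B) →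
    Tendsto (fun n => ∫ x, f x ∂(μs n : Measure ℝ)) atTop (𝓝 (∫ x, f x ∂(μ : Measure ℝ)))) ∧
  ∃ Ψ : ℕ → ℕ →. ℕ, Partrec₂ Ψ ∧
    ∀ (f : ℝ → ℝ) (e B : ℕ), IsRealFunctionIndex e f → (∀ x, |f x| ≤ B) →
      ∃ m ∈ Ψ e B, ∃ g : ℕ → ℕ, IsFunctionIndex m g ∧
        IsModulus g (fun n => ∫ x, f x ∂(μs n : Measure ℝ)) (∫ x, f x ∂(μ : Measure ℝ))

/-- The sequence `μs` weakly converges to `μ`: the integrals of every bounded continuous function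
converge. -/
def WeaklyConverges (μs : ℕ → FiniteMeasure ℝ) (μ : FiniteMeasure ℝ) : Prop :=
  ∀ f : BoundedContinuousFunction ℝ ℝ,
    Tendsto (fun n => ∫ x, f x ∂(μs n : Measure ℝ)) atTop (𝓝 (∫ x, f x ∂(μ : Measure ℝ)))

end EffWeak

/-!
Effective weak convergence contains, as its first clause, convergence of the integrals of each single
bounded computable function. This already determines weak convergence, because there are enough
computable functions: for `a : ℕ` and `b : ℤ` the ramp `x ↦ max 0 (min 1 (a * x + b))` is computable
(`exists_isRealFunctionIndex_ramp`), since it maps rationals to rationals primitive recursively and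
is `a`-Lipschitz, so that evaluating it along a shifted Cauchy name yields a Cauchy name.

The integrals of ramps, and hence of their linear combinations, converge. Those combinations contain
the constants, the piecewise linear interpolations of any function on the grids `{j / a}` in `[-R, R]`,
and a tail function `ψ` that is `1` off `[-R, R]` and `0` on `[-(R - 1), R - 1]`.
A continuous `f` with `|f| ≤ C` and its interpolation `g` on a fine grid satisfy
`|f - g| ≤ ε + 2 * C * ψ` on the whole line, and `∫ ψ ∂μ` is small for large `R`. As the integrals of
the bound converge too, no mass can escape to infinity (`tendsto_integral_of_abs_sub_le`).
-/

namespace EffWeak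

open MeasureTheory Filter Topology

/-! ### Computability of ramps -/

theorem exists_oracleCode_of_partrec {f : ℕ →. ℕ} (hf : Nat.Partrec f) :
    ∃ c : OracleCode, ∀ ρ, c.eval ρ = f := by
  induction hf with
  | zero => exact ⟨.zero, fun _ => rfl⟩
  | succ => exact ⟨.succ, fun _ => rfl⟩
  | left => exact ⟨.left, fun _ => rfl⟩
  | right => exact ⟨.right, fun _ => rfl⟩
  | pair _ _ hf hg =>
    obtain ⟨c, hc⟩ := hf
    obtain ⟨d, hd⟩ := hg
    exact ⟨.pair c d, fun ρ => by simp only [OracleCode.eval, hc, hd]; rfl⟩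
  | comp _ _ hf hg =>
    obtain ⟨c, hc⟩ := hf
    obtain ⟨d, hd⟩ := hg
    exact ⟨.comp c d, fun ρ => by simp only [OracleCode.eval, hc, hd]; rfl⟩
  | prec _ _ hf hg =>
    obtain ⟨c, hc⟩ := hf
    obtain ⟨d, hd⟩ := hg
    exact ⟨.prec c d, fun ρ => by simp only [OracleCode.eval, hc, hd]; rfl⟩
  | rfind _ hf =>
    obtain ⟨c, hc⟩ := hf
    exact ⟨.rfind c, fun ρ => by simp only [OracleCode.eval, hc]; rfl⟩

/-- The ramp of slope `a` and intercept `b`: the affine function `x ↦ a * x + b` truncated to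
`[0, 1]`. -/
def ramp (a : ℕ) (b : ℤ) (x : ℝ) : ℝ := max 0 (min 1 (a * x + b))

theorem ramp_nonneg (a : ℕ) (b : ℤ) (x : ℝ) : 0 ≤ ramp a b x := le_max_left _ _

theorem ramp_le_one (a : ℕ) (b : ℤ) (x : ℝ) : ramp a b x ≤ 1 :=
  max_le zero_le_one (min_le_left _ _)

theorem ramp_eq_zero {a : ℕ} {b : ℤ} {x : ℝ} (h : a * x + b ≤ 0) : ramp a b x = 0 :=
  max_eq_left ((min_le_right _ _).trans h)

theorem ramp_eq_one {a : ℕ} {b : ℤ} {x : ℝ} (h : 1 ≤ a * x + b) : ramp a b x = 1 := by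
  simp [ramp, h]

@[fun_prop]
theorem continuous_ramp (a : ℕ) (b : ℤ) : Continuous (ramp a b) := by
  unfold ramp
  fun_prop

theorem abs_ramp_sub_le (a : ℕ) (b : ℤ) (x y : ℝ) :
    |ramp a b x - ramp a b y| ≤ a * |x - y| := by
  have h : |(a * x + b : ℝ) - (a * y + b)| = a * |x - y| := by
    rw [add_sub_add_right_eq_sub, ← mul_sub, abs_mul, Nat.abs_cast]
  rw [← h]
  refine (abs_max_sub_max_le_max _ _ _ _).trans (max_le (by simp) ?_)
  exact (abs_min_sub_min_le_max _ _ _ _).trans (max_le (by simp) le_rfl)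

/-- The action of a ramp on codes of rationals. Truncated subtraction of the two parts of the
numerator provides the truncation at `0`. -/
def rampCode (a : ℕ) (b : ℤ) (n : ℕ) : ℕ :=
  Nat.pair
    (min (a * n.unpair.1 + b.toNat * (n.unpair.2.unpair.2 + 1)
      - (a * n.unpair.2.unpair.1 + (-b).toNat * (n.unpair.2.unpair.2 + 1)))
      (n.unpair.2.unpair.2 + 1))
    (Nat.pair 0 n.unpair.2.unpair.2)

theorem primrec_rampCode (a : ℕ) (b : ℤ) : Primrec (rampCode a b) := by
  have h1 : Primrec fun n : ℕ => n.unpair.1 := Primrec.fst.comp Primrec.unpair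
  have h2 : Primrec fun n : ℕ => n.unpair.2 := Primrec.snd.comp Primrec.unpair
  have hp := h1.comp h2
  have hd := Primrec.succ.comp (h2.comp h2)
  have hmul (k : ℕ) {f : ℕ → ℕ} (hf : Primrec f) : Primrec fun n => k * f n :=
    Primrec.nat_mul.comp (Primrec.const k) hf
  exact Primrec₂.natPair.comp
    (Primrec.nat_min.comp
      (Primrec.nat_sub.comp (Primrec.nat_add.comp (hmul a h1) (hmul b.toNat hd))
        (Primrec.nat_add.comp (hmul a hp) (hmul (-b).toNat hd))) hd)
    (Primrec₂.natPair.comp (Primrec.const 0) (h2.comp h2))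

theorem rat_rampCode (a : ℕ) (b : ℤ) (n : ℕ) :
    ((rat (rampCode a b n) : ℚ) : ℝ) = ramp a b (rat n : ℚ) := by
  have hb : (b : ℝ) = (b.toNat : ℝ) - ((-b).toNat : ℝ) := by
    have : b = (b.toNat : ℤ) - ((-b).toNat : ℤ) := by omega
    exact_mod_cast congrArg (Int.cast : ℤ → ℝ) this
  unfold rat rampCode ramp
  simp only [Nat.unpair_pair]
  rw [hb]
  push_cast
  generalize n.unpair.1 = p
  generalize n.unpair.2.unpair.1 = q
  generalize n.unpair.2.unpair.2 = d
  generalize b.toNat = r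
  generalize (-b).toNat = s
  have hd : (0 : ℝ) < (d : ℝ) + 1 := by positivity
  have hsub (u v : ℕ) : ((u - v : ℕ) : ℝ) = max 0 ((u : ℝ) - v) := by
    rcases le_total u v with h | h
    · rw [Nat.sub_eq_zero_of_le h, max_eq_left (by simpa using h), Nat.cast_zero]
    · rw [Nat.cast_sub h, max_eq_right (by simpa using h)]
  rw [hsub, sub_zero, ← min_div_div_right hd.le, ← max_div_div_right hd.le, zero_div,
    div_self hd.ne', max_min_distrib_left, min_comm, max_eq_right zero_le_one]
  congr 2
  push_cast
  field_simp
  ring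

theorem exists_isRealFunctionIndex_ramp (a : ℕ) (b : ℤ) :
    ∃ e, IsRealFunctionIndex e (ramp a b) := by
  obtain ⟨c, hc⟩ := exists_oracleCode_of_partrec
    (Nat.Partrec.of_primrec (Primrec.nat_iff.1 (primrec_rampCode a b)))
  -- The shift by `a` compensates the Lipschitz constant, as `a < 2 ^ a`.
  obtain ⟨d, hd⟩ := exists_oracleCode_of_partrec
    (Nat.Partrec.of_primrec (Primrec.nat_iff.1 (Primrec.nat_add.comp Primrec.id (Primrec.const a))))
  refine ⟨_, .comp c (.comp .oracle d), rfl, fun x ρ ⟨hlim, hρ⟩ =>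
    ⟨fun n => rampCode a b (ρ (n + a)), fun n => ?_, ?_, fun n => ?_⟩⟩
  · simp only [OracleCode.eval, hc, hd]
    exact Part.mem_bind (Part.mem_bind (Part.mem_some _) (Part.mem_some _)) (Part.mem_some _)
  · simp only [rat_rampCode]
    exact ((continuous_ramp a b).tendsto x).comp (hlim.comp (tendsto_add_atTop_nat a))
  · have h1 : |((rat (ρ (n + a)) : ℚ) : ℝ) - (rat (ρ (n + 1 + a)) : ℚ)| ≤ (1 / 2 : ℝ) ^ (n + a) := by
      have := (Rat.cast_le (K := ℝ)).2 (hρ (n + a)).le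
      rw [show n + a + 1 = n + 1 + a by ring] at this
      push_cast at this
      exact this
    have h2 : (a : ℝ) < 2 ^ a := by exact_mod_cast Nat.lt_two_pow_self
    suffices h : |((rat (rampCode a b (ρ (n + a))) : ℚ) : ℝ)
        - (rat (rampCode a b (ρ (n + 1 + a))) : ℚ)| < (1 / 2 : ℝ) ^ n by
      refine (Rat.cast_lt (K := ℝ)).1 ?_
      push_cast
      exact h
    rw [rat_rampCode, rat_rampCode]
    calc |ramp a b (rat (ρ (n + a)) : ℚ) - ramp a b (rat (ρ (n + 1 + a)) : ℚ)|
        ≤ a * (1 / 2 : ℝ) ^ (n + a) :=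
          (abs_ramp_sub_le a b _ _).trans (mul_le_mul_of_nonneg_left h1 a.cast_nonneg)
      _ < 2 ^ a * (1 / 2 : ℝ) ^ (n + a) := by gcongr
      _ = (1 / 2 : ℝ) ^ n := by
          rw [pow_add, mul_left_comm, ← mul_pow]
          norm_num

/-! ### Piecewise linear interpolation by ramps -/

/-- The piecewise linear function with value `c j` at the grid point `(j - b) / a` for `j ≤ N`,
constant to the left of the first and to the right of the last of these points. -/
def interp (a b : ℕ) (c : ℕ → ℝ) (N : ℕ) (x : ℝ) : ℝ :=
  c 0 + ∑ j ∈ Finset.range N, (c (j + 1) - c j) * ramp a ((b : ℤ) - j) x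

theorem interp_succ (a b : ℕ) (c : ℕ → ℝ) (N : ℕ) (x : ℝ) :
    interp a b c (N + 1) x = interp a b c N x + (c (N + 1) - c N) * ramp a ((b : ℤ) - N) x := by
  rw [interp, Finset.sum_range_succ, ← add_assoc, interp]

theorem interp_of_ge {a b : ℕ} (c : ℕ → ℝ) {N : ℕ} {x : ℝ} (h : (N : ℝ) ≤ a * x + b) :
    interp a b c N x = c N := by
  have h1 : ∀ j ∈ Finset.range N, (c (j + 1) - c j) * ramp a ((b : ℤ) - j) x = c (j + 1) - c j := by
    intro j hj
    have : (j : ℝ) + 1 ≤ N := by exact_mod_cast Finset.mem_range.1 hj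
    rw [ramp_eq_one (by push_cast; linarith), mul_one]
  rw [interp, Finset.sum_congr rfl h1, Finset.sum_range_sub]
  ring

/-- An interpolated value lies in every convex set that contains the interpolated data at the
neighbouring grid points; beyond the ends of the grid, only the end points count as neighbours. -/
theorem interp_mem {a b : ℕ} {c : ℕ → ℝ} {N : ℕ} {x : ℝ} {K : Set ℝ} (hK : Convex ℝ K)
    (h : ∀ j ≤ N, (j = 0 ∨ (j : ℝ) ≤ a * x + b + 1) → (j = N ∨ a * x + b ≤ (j : ℝ) + 1) → c j ∈ K) :
    interp a b c N x ∈ K := by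
  induction N with
  | zero => simpa [interp] using h 0 le_rfl (Or.inl rfl) (Or.inl rfl)
  | succ N ih =>
    rw [interp_succ]
    rcases le_total (a * x + b : ℝ) N with hx | hx
    · rw [ramp_eq_zero (by push_cast; linarith), mul_zero, add_zero]
      refine ih fun j hj h0 h1 => h j (by omega) h0 (Or.inr ?_)
      rcases h1 with rfl | h1 <;> linarith
    · rw [interp_of_ge c hx]
      have hN1 : c (N + 1) ∈ K := h (N + 1) le_rfl (Or.inr (by push_cast; linarith)) (Or.inl rfl)
      rcases le_total (a * x + b : ℝ) (N + 1) with hx1 | hx1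
      · have hN : c N ∈ K := h N (by omega) (Or.inr (by linarith)) (Or.inr (by linarith))
        have := hK hN hN1 (sub_nonneg.2 (ramp_le_one a ((b : ℤ) - N) x)) (ramp_nonneg a _ x)
          (by ring)
        convert this using 1
        simp only [smul_eq_mul]
        ring
      · rw [ramp_eq_one (by push_cast; linarith)]
        simpa using hN1

/-- A continuous function that indicates the tails of the line: it is `1` off `[-R, R]` and `0` on
`[-(R - 1), R - 1]`. -/
def tail (R : ℕ) (x : ℝ) : ℝ := 1 - ramp 1 R x + ramp 1 (1 - R) x

@[fun_prop]
theorem continuous_tail (R : ℕ) : Continuous (tail R) := by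
  unfold tail
  fun_prop

theorem tail_nonneg (R : ℕ) (x : ℝ) : 0 ≤ tail R x := by
  have := ramp_le_one 1 R x
  have := ramp_nonneg 1 (1 - R) x
  unfold tail
  linarith

theorem tail_le_two (R : ℕ) (x : ℝ) : tail R x ≤ 2 := by
  have := ramp_nonneg 1 R x
  have := ramp_le_one 1 (1 - R) x
  unfold tail
  linarith

theorem one_le_tail {R : ℕ} {x : ℝ} (h : (R : ℝ) < |x|) : 1 ≤ tail R x := by
  have h0 := ramp_le_one 1 R x
  have h1 := ramp_nonneg 1 (1 - R) x
  unfold tail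
  rcases lt_abs.1 h with h | h
  · rw [ramp_eq_one (b := 1 - R) (by push_cast; linarith)]
    linarith
  · rw [ramp_eq_zero (b := R) (by push_cast; linarith)]
    linarith

theorem tail_eq_zero {R : ℕ} {x : ℝ} (h : |x| + 1 ≤ R) : tail R x = 0 := by
  have := abs_le.1 (le_refl |x|)
  rw [tail, ramp_eq_one (by push_cast; linarith), ramp_eq_zero (by push_cast; linarith)]
  ring

theorem tendsto_integral_tail (μ : Measure ℝ) [IsFiniteMeasure μ] :
    Tendsto (fun R : ℕ => ∫ x, tail R x ∂μ) atTop (𝓝 0) := by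
  rw [← integral_zero ℝ ℝ (μ := μ)]
  refine tendsto_integral_of_dominated_convergence (fun _ => 2)
    (fun R => (continuous_tail R).aestronglyMeasurable) (integrable_const _)
    (fun R => ae_of_all _ fun x => ?_) (ae_of_all _ fun x => ?_)
  · rw [Real.norm_of_nonneg (tail_nonneg R x)]
    exact tail_le_two R x
  · refine tendsto_const_nhds.congr' ?_
    obtain ⟨m, hm⟩ := exists_nat_ge (|x| + 1)
    filter_upwards [eventually_ge_atTop m] with R hR
    exact (tail_eq_zero (hm.trans (by exact_mod_cast hR))).symm

/-- A bounded continuous function on the line is approximated by interpolations, up to an error that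
is small on `[-R, R]`. -/
theorem exists_abs_sub_interp_le {f : ℝ → ℝ} (hf : Continuous f) {C : ℝ} (hC : ∀ x, |f x| ≤ C)
    (R : ℕ) {ε : ℝ} (hε : 0 < ε) :
    ∃ (a b : ℕ) (c : ℕ → ℝ) (N : ℕ), ∀ x, |f x - interp a b c N x| ≤ ε + 2 * C * tail R x := by
  have huc := (isCompact_Icc (a := -(R : ℝ)) (b := R)).uniformContinuousOn_of_continuous
    hf.continuousOn
  obtain ⟨δ, hδ, h⟩ := Metric.uniformContinuousOn_iff.1 huc ε hε
  obtain ⟨m, hm⟩ := exists_nat_one_div_lt hδ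
  set a := m + 1 with ha
  have ha0 : (0 : ℝ) < a := by positivity
  have hm : 1 < δ * a := by
    rw [div_lt_iff₀ (by positivity)] at hm
    simpa [ha] using hm
  have hC0 : 0 ≤ C := (abs_nonneg _).trans (hC 0)
  refine ⟨a, R * a, fun j => f ((j - (R * a : ℕ)) / a), 2 * (R * a), fun x => ?_⟩
  rcases lt_or_ge (R : ℝ) |x| with hx | hx
  · have hg : interp a (R * a) (fun j => f ((j - (R * a : ℕ)) / a)) (2 * (R * a)) x
        ∈ Set.Icc (-C) C :=
      interp_mem (convex_Icc _ _) fun j _ _ _ => abs_le.1 (hC _)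
    have h1 := abs_le.1 (hC x)
    have h2 := le_mul_of_one_le_right (mul_nonneg zero_le_two hC0) (one_le_tail hx)
    rw [abs_le]
    constructor <;> linarith [hg.1, hg.2]
  · have hx' := abs_le.1 hx
    have hg : interp a (R * a) (fun j => f ((j - (R * a : ℕ)) / a)) (2 * (R * a)) x
        ∈ Set.Icc (f x - ε) (f x + ε) := by
      refine interp_mem (convex_Icc _ _) fun j hj h0 h1 => ?_
      have hj' : (j : ℝ) ≤ 2 * (R * a) := by exact_mod_cast hj
      have hax : -(R * a : ℝ) ≤ a * x ∧ a * x ≤ R * a := by constructor <;> nlinarith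
      push_cast at h0 h1 ⊢
      have h0' : (j : ℝ) ≤ a * x + R * a + 1 := by
        rcases h0 with rfl | h0
        · push_cast
          linarith
        · exact h0
      have h1' : a * x + R * a ≤ (j : ℝ) + 1 := by
        rcases h1 with rfl | h1
        · push_cast
          linarith
        · exact h1
      have hmem : ((j : ℝ) - R * a) / a ∈ Set.Icc (-(R : ℝ)) R := by
        constructor
        · rw [le_div_iff₀ ha0]
          linarith [j.cast_nonneg (α := ℝ)]
        · rw [div_le_iff₀ ha0]
          linarith
      have hdist : dist (((j : ℝ) - R * a) / a) x < δ := by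
        have : ((j : ℝ) - R * a) / a - x = (j - R * a - a * x) / a := by
          field_simp
        rw [Real.dist_eq, this, abs_div, abs_of_pos ha0, div_lt_iff₀ ha0]
        refine lt_of_le_of_lt (abs_le.2 ⟨?_, ?_⟩) hm <;> linarith
      have := abs_lt.1 (Real.dist_eq _ _ ▸ h _ hmem x hx' hdist)
      constructor <;> linarith [this.1, this.2]
    have h2 : 0 ≤ 2 * C * tail R x :=
      mul_nonneg (mul_nonneg zero_le_two hC0) (tail_nonneg R x)
    rw [abs_le]
    constructor <;> linarith [hg.1, hg.2]

/-! ### From test functions to weak convergence -/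

/-- `f` is integrable for all measures involved, and its integrals converge. -/
def IntegralsConverge (μs : ℕ → FiniteMeasure ℝ) (μ : FiniteMeasure ℝ) (f : ℝ → ℝ) : Prop :=
  (∀ n, Integrable f (μs n : Measure ℝ)) ∧ Integrable f (μ : Measure ℝ) ∧
    Tendsto (fun n => ∫ x, f x ∂(μs n : Measure ℝ)) atTop (𝓝 (∫ x, f x ∂(μ : Measure ℝ)))

variable {μs : ℕ → FiniteMeasure ℝ} {μ : FiniteMeasure ℝ}

theorem IntegralsConverge.add {f g : ℝ → ℝ} (hf : IntegralsConverge μs μ f)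
    (hg : IntegralsConverge μs μ g) : IntegralsConverge μs μ fun x => f x + g x := by
  refine ⟨fun n => (hf.1 n).add (hg.1 n), hf.2.1.add hg.2.1, ?_⟩
  rw [integral_add hf.2.1 hg.2.1]
  simp_rw [fun n => integral_add (hf.1 n) (hg.1 n)]
  exact hf.2.2.add hg.2.2

theorem IntegralsConverge.const_mul {f : ℝ → ℝ} (hf : IntegralsConverge μs μ f) (c : ℝ) :
    IntegralsConverge μs μ fun x => c * f x := by
  refine ⟨fun n => (hf.1 n).const_mul c, hf.2.1.const_mul c, ?_⟩
  simp_rw [integral_const_mul]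
  exact hf.2.2.const_mul c

/-- If `f` is approximated by functions with convergent integrals, with an error bounded by functions
that have convergent integrals as well and an arbitrarily small integral in the limit, then the
integrals of `f` converge. -/
theorem tendsto_integral_of_abs_sub_le {f : ℝ → ℝ} (hfn : ∀ n, Integrable f (μs n : Measure ℝ))
    (hfμ : Integrable f (μ : Measure ℝ))
    (h : ∀ ε > 0, ∃ g ψ, IntegralsConverge μs μ g ∧ IntegralsConverge μs μ ψ ∧
      (∀ x, |f x - g x| ≤ ψ x) ∧ ∫ x, ψ x ∂(μ : Measure ℝ) < ε) :
    Tendsto (fun n => ∫ x, f x ∂(μs n : Measure ℝ)) atTop (𝓝 (∫ x, f x ∂(μ : Measure ℝ))) := by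
  have key {ν : Measure ℝ} {g ψ : ℝ → ℝ} (hf : Integrable f ν) (hg : Integrable g ν)
      (hψ : Integrable ψ ν) (hle : ∀ x, |f x - g x| ≤ ψ x) :
      |∫ x, f x ∂ν - ∫ x, g x ∂ν| ≤ ∫ x, ψ x ∂ν := by
    rw [← integral_sub hf hg]
    exact abs_integral_le_integral_abs.trans (integral_mono (hf.sub hg).abs hψ hle)
  rw [Metric.tendsto_atTop']
  intro ε hε
  obtain ⟨g, ψ, hg, hψ, hle, hlt⟩ := h (ε / 3) (by positivity)
  obtain ⟨N, hN⟩ := eventually_atTop.1 ((hψ.2.2.eventually_lt_const hlt).and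
    (Metric.tendsto_nhds.1 hg.2.2 (ε / 3) (by positivity)))
  refine ⟨N, fun n hn => ?_⟩
  obtain ⟨h1, h2⟩ := hN n hn.le
  have h3 := abs_le.1 (key (hfn n) (hg.1 n) (hψ.1 n) hle)
  have h4 := abs_le.1 (key hfμ hg.2.1 hψ.2.1 hle)
  rw [Real.dist_eq] at h2 ⊢
  rw [abs_lt] at h2 ⊢
  constructor <;> linarith

theorem EffectivelyWeaklyConverges.integralsConverge_ramp
    (h : EffectivelyWeaklyConverges μs μ) (a : ℕ) (b : ℤ) : IntegralsConverge μs μ (ramp a b) := by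
  have hb : ∀ x, |ramp a b x| ≤ 1 := fun x =>
    (abs_of_nonneg (ramp_nonneg a b x)).trans_le (ramp_le_one a b x)
  have hi (ν : Measure ℝ) [IsFiniteMeasure ν] : Integrable (ramp a b) ν :=
    .of_bound (continuous_ramp a b).aestronglyMeasurable 1 (ae_of_all _ hb)
  exact ⟨fun n => hi _, hi _, h.1 _ (exists_isRealFunctionIndex_ramp a b) ⟨1, hb⟩⟩

theorem EffectivelyWeaklyConverges.integralsConverge_const
    (h : EffectivelyWeaklyConverges μs μ) (c : ℝ) : IntegralsConverge μs μ fun _ => c := by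
  simpa [ramp] using (h.integralsConverge_ramp 0 1).const_mul c

theorem EffectivelyWeaklyConverges.integralsConverge_interp
    (h : EffectivelyWeaklyConverges μs μ) (a b : ℕ) (c : ℕ → ℝ) (N : ℕ) :
    IntegralsConverge μs μ (interp a b c N) := by
  induction N with
  | zero =>
    rw [show interp a b c 0 = fun _ => c 0 from funext fun x => by simp [interp]]
    exact h.integralsConverge_const (c 0)
  | succ N ih =>
    rw [funext (interp_succ a b c N)]
    exact ih.add ((h.integralsConverge_ramp _ _).const_mul _)

theorem EffectivelyWeaklyConverges.integralsConverge_tail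
    (h : EffectivelyWeaklyConverges μs μ) (R : ℕ) : IntegralsConverge μs μ (tail R) := by
  convert ((h.integralsConverge_const 1).add ((h.integralsConverge_ramp 1 R).const_mul (-1))).add
    (h.integralsConverge_ramp 1 (1 - R)) using 2 with x
  rw [tail]
  ring

theorem EffectivelyWeaklyConverges.weaklyConverges
    (h : EffectivelyWeaklyConverges μs μ) : WeaklyConverges μs μ := by
  intro f
  refine tendsto_integral_of_abs_sub_le (fun n => f.integrable _) (f.integrable _) fun ε hε => ?_
  set m := (μ : Measure ℝ).real Set.univ
  have hm : 0 ≤ m := measureReal_nonneg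
  have hη : 0 < ε / (2 * (m + 1)) := by positivity
  have hlim := (tendsto_integral_tail (μ : Measure ℝ)).const_mul (2 * ‖f‖)
  rw [mul_zero] at hlim
  obtain ⟨R, hR⟩ := (hlim.eventually_lt_const (half_pos hε)).exists
  obtain ⟨a, b, c, N, hle⟩ := exists_abs_sub_interp_le f.continuous f.norm_coe_le_norm R hη
  refine ⟨_, _, h.integralsConverge_interp a b c N,
    (h.integralsConverge_const _).add ((h.integralsConverge_tail R).const_mul _), hle, ?_⟩
  rw [integral_add (integrable_const _) ((h.integralsConverge_tail R).2.1.const_mul _),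
    integral_const_mul, integral_const, smul_eq_mul]
  have : m * (ε / (2 * (m + 1))) ≤ ε / 2 := by
    rw [← mul_div_assoc, div_le_div_iff₀ (by positivity) two_pos]
    nlinarith
  linarith

end EffWeak

theorem corollary4p7 (μs : ℕ → MeasureTheory.FiniteMeasure ℝ) (μ : MeasureTheory.FiniteMeasure ℝ)
    (hμs : EffWeak.UniformlyComputable μs)
    (hconv : EffWeak.EffectivelyWeaklyConverges μs μ) :
    EffWeak.WeaklyConverges μs μ :=
  hconv.weaklyConverges
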